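/- **Setting.** Let $Y_1,\dots,Y_{n+1}$ be $\{0,1\}$-valued random variables ($1$ is a "failure") whose joint law $Q$ is permutation invariant; write $\mathcal Q_{n+1}$ for the set of all such laws. Let $0\le\lambda<1$ and $\nu=1-\lambda$. Given $Y_1,\dots,Y_n$, let $U_1,\dots,U_n$ be conditionally independent with $U_i=0$ if $Y_i=0$, and $U_i=0$ with probability $\lambda$, $U_i=1$ with probability $1-\lambda$, if $Y_i=1$. Let $K$ and $L$ be the numbers of failures among $Y_1,\dots,Y_n$ and among $U_1,\dots,U_n$. For $0<\delta\le1$ define the upper confidence limits $$\overline\epsilon_0(k,n,\delta)=\max_{Q\in\mathcal Q_{n+1}}\{Q(Y_{n+1}=1\mid K\le k)\;:\;Q(K\le k)\ge\delta\},$$ $$\overline\epsilon_\lambda(l,n,\delta)=\max_{Q\in\mathcal Q_{n+1}}\{Q(Y_{n+1}=1\mid L\le l)\;:\;Q(L\le l)\ge\delta\}.$$ Let $B_{z,l}=\sum_{j=0}^{l}\binom zj\nu^j\lambda^{z-j}$ and $\Delta_{z,l}=B_{z,l}-B_{z+1,l}$. For $0<\lambda<1$ and $0<\delta<1$ let $z^*=\min\{z\in\mathbb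 Z,\ z\ge l : B_{z,l}\le\delta\}$ and $z_*=z^*-1$, and define $$G(l,\delta,\lambda)=\frac{(B_{z_*,l}-\delta)\,z^*B_{z_*,l}+(\delta-B_{z^*,l})\,z_*B_{z_*-1,l}}{\delta\,\Delta_{z_*,l}},$$ where the term $z_*B_{z_*-1,l}$ is $0$ if $z_*=0$. **Theorem.** Fix $0<\lambda<1$ and an integer $k_0\ge0$, and let $l=\lceil\nu k_0\rceil$. (a) For every fixed $0<\delta<1$, as $n\to\infty$, $$\overline\epsilon_0(k_0,n,\delta)=\frac{k_0+1-\delta}{\delta}\,\frac1n+o\Big(\frac1n\Big),\qquad \overline\epsilon_\lambda(l,n,\delta)=\frac{G(l,\delta,\lambda)}{n}+o\Big(\frac1n\Big).$$ (b) For every fixed $r>0$: - $\overline\epsilon_0(k_0,n,e^{-rn})=1$ for all sufficiently large $n$; - if $r\le\ln\lambda^{-1}$, then $\displaystyle\lim_{n\to\infty}\overline\epsilon_\lambda(l,n,e^{-rn})=\frac{r}{r+\lambda(\ln\lambda^{-1}-r)}$; - if $r>\ln\lambda^{-1}$, then $\overline\epsilon_\lambda(l,n,e^{-rn})=1$ for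 all sufficiently large $n$. -/

import Mathlib

open Filter Topology Asymptotics

namespace RandomSampling

noncomputable section

/-- Permutation invariant probability mass functions on `{0,1}^m`. -/
def permInvariantLaws (m : ℕ) : Set ((Fin m → Fin 2) → ℝ) :=
  {Q | Q ∈ stdSimplex ℝ (Fin m → Fin 2) ∧
    ∀ (σ : Equiv.Perm (Fin m)) (y : Fin m → Fin 2), Q (fun i => y (σ i)) = Q y}

/-- The number of failures in a `{0,1}`-string (`1` is a failure, `0` a success). -/
def failures {m : ℕ} (y : Fin m → Fin 2) : ℕ :=
  (Finset.univ.filter fun i => y i = 1).card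

/-- The observed part `(y_1, ..., y_n)` of `(y_1, ..., y_{n+1})`. -/
def observed {n : ℕ} (y : Fin (n + 1) → Fin 2) : Fin n → Fin 2 := fun i => y i.castSucc

/-- The noise `P_{U|Y}(u|y)` with randomization parameter `lam`: a success stays a success, and
a failure is turned into a success with probability `lam`. -/
def noise (lam : ℝ) (y u : Fin 2) : ℝ :=
  if y = 0 then (if u = 0 then 1 else 0) else (if u = 0 then lam else 1 - lam)

/-- The joint mass function of `(Y_1, ..., Y_{n+1})` and `(U_1, ..., U_n)` under `Q`: given the
`Y_i`, the `U_i` are drawn independently, `U_i` from `P_{U|Y}(· | Y_i)`. -/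
def jointLaw (lam : ℝ) {n : ℕ} (Q : (Fin (n + 1) → Fin 2) → ℝ)
    (y : Fin (n + 1) → Fin 2) (u : Fin n → Fin 2) : ℝ :=
  Q y * ∏ i, noise lam (observed y i) (u i)

/-- `Q(K ≤ k)`, where `K` is the number of failures among `Y_1, ..., Y_n`. -/
def probK {n : ℕ} (Q : (Fin (n + 1) → Fin 2) → ℝ) (k : ℕ) : ℝ :=
  ∑ y with failures (observed y) ≤ k, Q y

/-- `Q(Y_{n+1} = 1, K ≤ k)`. -/
def probFailK {n : ℕ} (Q : (Fin (n + 1) → Fin 2) → ℝ) (k : ℕ) : ℝ :=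
  ∑ y with y (Fin.last n) = 1 ∧ failures (observed y) ≤ k, Q y

/-- `Q(L ≤ l)`, where `L` is the number of failures among `U_1, ..., U_n`. -/
def probL (lam : ℝ) {n : ℕ} (Q : (Fin (n + 1) → Fin 2) → ℝ) (l : ℕ) : ℝ :=
  ∑ y, ∑ u with failures u ≤ l, jointLaw lam Q y u

/-- `Q(Y_{n+1} = 1, L ≤ l)`. -/
def probFailL (lam : ℝ) {n : ℕ} (Q : (Fin (n + 1) → Fin 2) → ℝ) (l : ℕ) : ℝ :=
  ∑ y with y (Fin.last n) = 1, ∑ u with failures u ≤ l, jointLaw lam Q y u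

/-- The upper confidence limit of the deterministic test: the maximum of `Q(Y_{n+1} = 1 | K ≤ k)`
over permutation invariant `Q` with `Q(K ≤ k) ≥ δ`. -/
def upperLimitDet (k n : ℕ) (δ : ℝ) : ℝ :=
  sSup ((fun Q => probFailK Q k / probK Q k) '' {Q ∈ permInvariantLaws (n + 1) | δ ≤ probK Q k})

/-- The upper confidence limit of the randomized test: the maximum of `Q(Y_{n+1} = 1 | L ≤ l)`
over permutation invariant `Q` with `Q(L ≤ l) ≥ δ`. -/
def upperLimit (lam : ℝ) (l n : ℕ) (δ : ℝ) : ℝ :=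
  sSup ((fun Q => probFailL lam Q l / probL lam Q l) ''
    {Q ∈ permInvariantLaws (n + 1) | δ ≤ probL lam Q l})

/-- The binomial distribution function `B_{z,l}(p)`. -/
def binomCDF (z l : ℕ) (p : ℝ) : ℝ :=
  ∑ j ∈ Finset.range (l + 1), (z.choose j : ℝ) * p ^ j * (1 - p) ^ (z - j)

/-- `z^*(l, δ, lam) = min {z ≥ l | B_{z,l}(1 - lam) ≤ δ}`. -/
def zUpper (l : ℕ) (δ lam : ℝ) : ℕ := sInf {z : ℕ | l ≤ z ∧ binomCDF z l (1 - lam) ≤ δ}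

/-- `z_* = z^* - 1`. For `δ < 1` one has `z^* ≥ l + 1`, so the subtraction is the usual one. -/
def zLower (l : ℕ) (δ lam : ℝ) : ℕ := zUpper l δ lam - 1

/-- The difference `Δ_{z,l} = B_{z,l} - B_{z+1,l}` at `p = 1 - lam`. -/
def binomDiff (z l : ℕ) (lam : ℝ) : ℝ :=
  binomCDF z l (1 - lam) - binomCDF (z + 1) l (1 - lam)

/-- The coefficient `G(l, δ, lam)`. If `z_* = 0`, the term with index `z_* - 1` has factor `0`. -/
def coeffG (l : ℕ) (δ lam : ℝ) : ℝ :=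
  ((binomCDF (zLower l δ lam) l (1 - lam) - δ) *
        (zUpper l δ lam * binomCDF (zLower l δ lam) l (1 - lam)) +
      (δ - binomCDF (zUpper l δ lam) l (1 - lam)) *
        (zLower l δ lam * binomCDF (zLower l δ lam - 1) l (1 - lam))) /
    (δ * binomDiff (zLower l δ lam) l lam)

lemma isCompact_permInvariantLaws (m : ℕ) : IsCompact (permInvariantLaws m) := by
  have h : permInvariantLaws m = stdSimplex ℝ (Fin m → Fin 2) ∩
      ⋂ (σ : Equiv.Perm (Fin m)) (y : Fin m → Fin 2),
        {Q : (Fin m → Fin 2) → ℝ | Q (fun i => y (σ i)) = Q y} := by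
    ext Q; simp [permInvariantLaws]
  rw [h]
  refine (isCompact_stdSimplex ℝ (Fin m → Fin 2)).inter_right ?_
  exact isClosed_iInter fun σ => isClosed_iInter fun y =>
    isClosed_eq (continuous_apply _) (continuous_apply _)

lemma single_mem_permInvariantLaws (m : ℕ) :
    (Pi.single (fun _ => 0) 1 : (Fin m → Fin 2) → ℝ) ∈ permInvariantLaws m := by
  refine ⟨single_mem_stdSimplex ℝ _, fun σ y => ?_⟩
  have h : ((fun i => y (σ i)) = fun _ => (0 : Fin 2)) ↔ y = fun _ => 0 := by
    constructor
    · intro h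
      funext i
      simpa using congrFun h (σ.symm i)
    · rintro rfl; rfl
  simp only [Pi.single_apply, h]

lemma sum_noise_zero {n : ℕ} (lam : ℝ) (l : ℕ) :
    ∑ u : Fin n → Fin 2 with failures u ≤ l, ∏ i, noise lam 0 (u i) = 1 := by
  rw [Finset.sum_eq_single (fun _ => 0)]
  · simp [noise]
  · intro u _ hu
    obtain ⟨i, hi⟩ : ∃ i, u i ≠ 0 := by
      by_contra! h
      exact hu (funext h)
    exact Finset.prod_eq_zero (Finset.mem_univ i) (by simp [noise, hi])
  · intro h
    exact absurd (Finset.mem_filter.2 ⟨Finset.mem_univ _, by simp [failures]⟩) h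

/-- The supremum in `upperLimit` is a maximum. -/
lemma upperLimit_isGreatest (lam : ℝ) (l n : ℕ) {δ : ℝ} (h0 : 0 < δ) (h1 : δ ≤ 1) :
    IsGreatest ((fun Q => probFailL lam Q l / probL lam Q l) ''
      {Q ∈ permInvariantLaws (n + 1) | δ ≤ probL lam Q l}) (upperLimit lam l n δ) := by
  have hc : Continuous fun Q : (Fin (n + 1) → Fin 2) → ℝ => probL lam Q l := by
    unfold probL jointLaw; fun_prop
  have hc' : Continuous fun Q : (Fin (n + 1) → Fin 2) → ℝ => probFailL lam Q l := by
    unfold probFailL jointLaw; fun_prop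
  refine IsCompact.isGreatest_sSup (IsCompact.image_of_continuousOn
    ((isCompact_permInvariantLaws _).inter_right (isClosed_le continuous_const hc))
    (hc'.continuousOn.div hc.continuousOn fun Q hQ => (h0.trans_le hQ.2).ne')) ?_
  refine Set.Nonempty.image _ ⟨_, single_mem_permInvariantLaws _, ?_⟩
  have : probL lam (Pi.single (fun _ => 0) 1 : (Fin (n + 1) → Fin 2) → ℝ) l = 1 := by
    unfold probL jointLaw
    rw [Finset.sum_eq_single (fun _ => 0)]
    · simpa [observed] using sum_noise_zero lam l
    · intro y _ hy
      simp [Pi.single_eq_of_ne hy]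
    · simp
  rw [this]; exact h1

/-- Without noise, `U_i = Y_i`. -/
lemma sum_noise_det {n : ℕ} (l : ℕ) (y : Fin n → Fin 2) :
    ∑ u : Fin n → Fin 2 with failures u ≤ l, ∏ i, noise 0 (y i) (u i) =
      if failures y ≤ l then 1 else 0 := by
  have h : ∀ u : Fin n → Fin 2, ∏ i, noise 0 (y i) (u i) = if u = y then 1 else 0 := by
    intro u
    have h2 : ∀ a b : Fin 2, noise 0 a b = if b = a then 1 else 0 := by
      intro a b; fin_cases a <;> fin_cases b <;> simp [noise]
    simp only [h2]
    split_ifs with hu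
    · simp [hu]
    · obtain ⟨i, hi⟩ : ∃ i, u i ≠ y i := by
        by_contra! h
        exact hu (funext h)
      exact Finset.prod_eq_zero (Finset.mem_univ i) (by simp [hi])
  simp only [h, Finset.sum_ite_eq', Finset.mem_filter, Finset.mem_univ, true_and]

/-- The deterministic test is the randomized test with parameter `0`. -/
lemma upperLimit_zero (k n : ℕ) (δ : ℝ) : upperLimit 0 k n δ = upperLimitDet k n δ := by
  have h1 : ∀ Q : (Fin (n + 1) → Fin 2) → ℝ, probL 0 Q k = probK Q k := by
    intro Q
    simp only [probL, probK, jointLaw, ← Finset.mul_sum, sum_noise_det]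
    simp only [mul_ite, mul_one, mul_zero, Finset.sum_filter]
  have h2 : ∀ Q : (Fin (n + 1) → Fin 2) → ℝ, probFailL 0 Q k = probFailK Q k := by
    intro Q
    simp only [probFailL, probFailK, jointLaw, ← Finset.mul_sum, sum_noise_det]
    simp only [mul_ite, mul_one, mul_zero, Finset.sum_filter, ite_and]
  simp only [upperLimit, upperLimitDet, h1, h2]

end

end RandomSampling

open RandomSampling

/-!
# Asymptotics of the upper confidence limits

Write `B z` for `binomCDF z l (1 - lam)`. A permutation invariant law on `{0,1}^(n+1)` is a mixture
of the uniform laws with exactly `z` failures, for which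
`P(Y_{n+1} = 1, L ≤ l) = z B (z-1) / (n+1)` (`failWeight`) and
`P(L ≤ l) = (z B (z-1) + (n+1-z) B z) / (n+1)` (`passWeight`). Hence the confidence limit is the
value of a linear program over mixtures. Any line `a x + b` with `b ≥ 0` above all the points
`(passWeight z, failWeight z)` bounds it by `a + b / δ` (`upperLimit_le`), and any mixture of two
uniform laws bounds it from below (`le_upperLimit`). The deterministic test is the case `lam = 0`.

For fixed `δ`, multiplication of `failWeight` by `n + 1` leads in the limit to the points
`(B z, z B (z-1))`. These lie on a concave curve (`slope_antitone`), because
`(z+1-l) B (z+1) ≤ lam (z+1) B z` holds termwise; so the line through the points with indices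
`zLower` and `zUpper` is a supporting line (`exists_supporting_line`), and its height at `δ` is
`δ` times `coeffG`. The difference between `passWeight z` and `B z` is `O(1/n)` uniformly in `z`, so
primal and dual bounds agree up to `o(1/n)` (`tendsto_mul_upperLimit`).

For `δ = exp (-r n)` let `ρ = r / log lam⁻¹`. As `B (z+1) ≥ lam B z`, a law with at most
`s (n+1)` failures has ratio `failWeight / passWeight` at most `s / (s + lam (1-s))`, while for more
failures `failWeight` is of order `lam ^ (s n)` up to a polynomial factor, which is negligible
against `δ` once `s > ρ` (`failWeight_le_of_proportion`). The law with `⌊ρ n⌋` failures is feasible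
because `B z ≥ lam ^ z`, and the ratio bound above shows that it attains the limit.
-/

namespace RandomSampling

/-! ### Reduction to the number of failures -/

lemma failures_eq_sum {m : ℕ} (y : Fin m → Fin 2) :
    failures y = ∑ i, if y i = 1 then 1 else 0 := by
  simp [failures]

lemma failures_le {m : ℕ} (y : Fin m → Fin 2) : failures y ≤ m :=
  (Finset.card_le_univ _).trans (by simp)

lemma failures_comp_perm {m : ℕ} (σ : Equiv.Perm (Fin m)) (y : Fin m → Fin 2) :
    failures (fun i => y (σ i)) = failures y := by
  simp only [failures_eq_sum]
  exact Equiv.sum_comp σ fun i => if y i = 1 then 1 else 0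

lemma failures_eq_observed {n : ℕ} (y : Fin (n + 1) → Fin 2) :
    failures y = failures (observed y) + if y (Fin.last n) = 1 then 1 else 0 := by
  rw [failures_eq_sum, failures_eq_sum, Fin.sum_univ_castSucc]
  rfl

open Polynomial in
/-- The generating polynomial of the number of failures after the noise has acted on `v`. -/
lemma sum_noise_mul_X_pow {n : ℕ} (lam : ℝ) (v : Fin n → Fin 2) :
    ∑ u : Fin n → Fin 2, C (∏ i, noise lam (v i) (u i)) * X ^ failures u =
      (C (1 - lam) * X + C lam) ^ failures v := by
  have h1 : ∀ u : Fin n → Fin 2, C (∏ i, noise lam (v i) (u i)) * X ^ failures u =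
      ∏ i, (C (noise lam (v i) (u i)) * if u i = 1 then X else 1) := by
    intro u
    rw [Finset.prod_mul_distrib, map_prod, Finset.prod_ite]
    simp [failures]
  have h2 := Finset.prod_univ_sum (fun _ : Fin n => (Finset.univ : Finset (Fin 2)))
    fun i c => (C (noise lam (v i) c) * if c = 1 then (X : ℝ[X]) else 1)
  rw [Fintype.piFinset_univ] at h2
  rw [Finset.sum_congr rfl fun u _ => h1 u, ← h2]
  have h3 : ∀ i, ∑ c : Fin 2, (C (noise lam (v i) c) * if c = 1 then (X : ℝ[X]) else 1) =
      if v i = 1 then C (1 - lam) * X + C lam else 1 := by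
    intro i
    generalize v i = a
    fin_cases a <;> simp [noise, add_comm]
  rw [Finset.prod_congr rfl fun i _ => h3 i, Finset.prod_ite]
  simp [failures]

/-- Given the failure pattern `v`, the number of failures after the noise is binomial. -/
lemma sum_noise_eq_binomCDF {n : ℕ} (lam : ℝ) (l : ℕ) (v : Fin n → Fin 2) :
    ∑ u : Fin n → Fin 2 with failures u ≤ l, ∏ i, noise lam (v i) (u i) =
      binomCDF (failures v) l (1 - lam) := by
  have h : ∀ j : ℕ, ∑ u : Fin n → Fin 2 with failures u = j, ∏ i, noise lam (v i) (u i) =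
      ((failures v).choose j : ℝ) * (1 - lam) ^ j * lam ^ (failures v - j) := by
    intro j
    have h := congrArg (fun p => Polynomial.coeff p j) (sum_noise_mul_X_pow lam v)
    simp only [Polynomial.finsetSum_coeff, Polynomial.coeff_C_mul, Polynomial.coeff_X_pow,
      add_pow, mul_pow, ← Polynomial.C_pow, mul_assoc, Polynomial.coeff_X_pow_mul'] at h
    rw [Finset.sum_filter]
    simp only [mul_ite, mul_one, mul_zero, eq_comm (a := j)] at h
    rw [h]
    have h' : ∀ m ∈ Finset.range (failures v + 1),
        (if m ≤ j then (1 - lam) ^ m * (lam ^ (failures v - m) *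
          ((failures v).choose m : Polynomial ℝ).coeff (j - m)) else 0) =
        if m = j then ((failures v).choose j : ℝ) * ((1 - lam) ^ j * lam ^ (failures v - j))
          else 0 := by
      intro m _
      rcases lt_trichotomy m j with hm | rfl | hm
      · rw [Polynomial.coeff_natCast_ite]
        simp [hm.le, hm.ne, (Nat.sub_pos_of_lt hm).ne']
      · rw [Polynomial.coeff_natCast_ite]
        simp; ring
      · simp [hm.ne', not_le.2 hm]
    rw [Finset.sum_congr rfl h', Finset.sum_ite_eq']
    split_ifs with hj
    · ring
    · rw [Nat.choose_eq_zero_of_lt (by simpa using hj)]; simp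
  unfold binomCDF
  rw [sub_sub_cancel, ← Finset.sum_congr rfl fun j _ => h j]
  rw [← Finset.sum_fiberwise_of_maps_to (s := Finset.univ.filter fun u : Fin n → Fin 2 =>
    failures u ≤ l) (t := Finset.range (l + 1)) (g := failures)
    (by intro u hu; simpa [Nat.lt_succ_iff] using hu)]
  refine Finset.sum_congr rfl fun j hj => ?_
  rw [Finset.filter_filter]
  refine Finset.sum_congr (Finset.filter_congr fun u _ => ?_) fun _ _ => rfl
  have := Finset.mem_range.1 hj
  constructor
  · exact fun h => h.2
  · exact fun h => ⟨by omega, h⟩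

/-- Exchangeability: the expectation of `φ` under a permutation invariant law is the expectation of
the average of `φ` over the exchanges of the last coordinate. -/
lemma sum_mul_eq_sum_swap {n : ℕ} {Q : (Fin (n + 1) → Fin 2) → ℝ}
    (hQ : Q ∈ permInvariantLaws (n + 1)) (φ : (Fin (n + 1) → Fin 2) → ℝ) :
    ((n : ℝ) + 1) * ∑ y, Q y * φ y =
      ∑ y, Q y * ∑ i, φ (fun j => y (Equiv.swap i (Fin.last n) j)) := by
  have h : ∀ i : Fin (n + 1), ∑ y, Q y * φ (fun j => y (Equiv.swap i (Fin.last n) j)) =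
      ∑ y, Q y * φ y := by
    intro i
    rw [← Equiv.sum_comp ((Equiv.swap i (Fin.last n)).arrowCongr (Equiv.refl (Fin 2)))
      fun y => Q y * φ y]
    refine Finset.sum_congr rfl fun y _ => ?_
    have : ((Equiv.swap i (Fin.last n)).arrowCongr (Equiv.refl (Fin 2))) y =
        fun j => y (Equiv.swap i (Fin.last n) j) := by
      funext j; simp [Equiv.arrowCongr]
    rw [this, hQ.2]
  simp only [Finset.mul_sum]
  rw [Finset.sum_comm, Finset.sum_congr rfl fun i _ => h i]
  simp [Finset.mul_sum]

/-- `P(Y_{n+1} = 1, L ≤ l)` when exactly `z` of the `n + 1` items are failures, in uniformly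
random order. -/
noncomputable def failWeight (lam : ℝ) (l n z : ℕ) : ℝ :=
  z * binomCDF (z - 1) l (1 - lam) / (n + 1)

/-- `P(L ≤ l)` when exactly `z` of the `n + 1` items are failures, in uniformly random order. -/
noncomputable def passWeight (lam : ℝ) (l n z : ℕ) : ℝ :=
  (z * binomCDF (z - 1) l (1 - lam) + ((n : ℝ) + 1 - z) * binomCDF z l (1 - lam)) / (n + 1)

lemma failures_observed_swap {n : ℕ} (y : Fin (n + 1) → Fin 2) (i : Fin (n + 1)) :
    failures (observed fun j => y (Equiv.swap i (Fin.last n) j)) =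
      failures y - if y i = 1 then 1 else 0 := by
  have h := failures_eq_observed fun j => y (Equiv.swap i (Fin.last n) j)
  rw [failures_comp_perm] at h
  simp only [Equiv.swap_apply_right] at h
  omega

lemma sum_boole_mul {m : ℕ} (y : Fin m → Fin 2) (a b : ℝ) :
    ∑ i, (if y i = 1 then a else b) = failures y * a + (m - failures y) * b := by
  have h : ∀ i, (if y i = 1 then a else b) = b + (if y i = 1 then 1 else 0) * (a - b) := by
    intro i; split_ifs <;> ring
  rw [Finset.sum_congr rfl fun i _ => h i, Finset.sum_add_distrib, ← Finset.sum_mul,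
    failures_eq_sum]
  push_cast
  simp only [Finset.sum_const, Finset.card_univ, Fintype.card_fin, nsmul_eq_mul]
  ring

lemma probL_eq {n : ℕ} {Q : (Fin (n + 1) → Fin 2) → ℝ} (hQ : Q ∈ permInvariantLaws (n + 1))
    (lam : ℝ) (l : ℕ) : probL lam Q l = ∑ y, Q y * passWeight lam l n (failures y) := by
  have h := sum_mul_eq_sum_swap hQ fun y => binomCDF (failures (observed y)) l (1 - lam)
  have h2 : probL lam Q l = ∑ y, Q y * binomCDF (failures (observed y)) l (1 - lam) := by
    simp only [probL, jointLaw, ← Finset.mul_sum, sum_noise_eq_binomCDF]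
  rw [← h2] at h
  have hn : (n : ℝ) + 1 ≠ 0 := by positivity
  refine mul_left_cancel₀ hn (h.trans ?_)
  rw [Finset.mul_sum]
  refine Finset.sum_congr rfl fun y _ => ?_
  have h3 : ∀ i, binomCDF (failures (observed fun j => y (Equiv.swap i (Fin.last n) j))) l
      (1 - lam) = if y i = 1 then binomCDF (failures y - 1) l (1 - lam)
        else binomCDF (failures y) l (1 - lam) := by
    intro i
    rw [failures_observed_swap]
    split_ifs <;> rfl
  rw [Finset.sum_congr rfl fun i _ => h3 i, sum_boole_mul, passWeight]
  push_cast
  field_simp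

lemma probFailL_eq {n : ℕ} {Q : (Fin (n + 1) → Fin 2) → ℝ} (hQ : Q ∈ permInvariantLaws (n + 1))
    (lam : ℝ) (l : ℕ) : probFailL lam Q l = ∑ y, Q y * failWeight lam l n (failures y) := by
  have h := sum_mul_eq_sum_swap hQ fun y =>
    if y (Fin.last n) = 1 then binomCDF (failures (observed y)) l (1 - lam) else 0
  have h2 : probFailL lam Q l = ∑ y, Q y *
      if y (Fin.last n) = 1 then binomCDF (failures (observed y)) l (1 - lam) else 0 := by
    simp only [probFailL, jointLaw, ← Finset.mul_sum, sum_noise_eq_binomCDF]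
    simp only [Finset.sum_filter, mul_ite, mul_zero]
  rw [← h2] at h
  have hn : (n : ℝ) + 1 ≠ 0 := by positivity
  refine mul_left_cancel₀ hn (h.trans ?_)
  rw [Finset.mul_sum]
  refine Finset.sum_congr rfl fun y _ => ?_
  have h3 : ∀ i, (if y (Equiv.swap i (Fin.last n) (Fin.last n)) = 1 then
      binomCDF (failures (observed fun j => y (Equiv.swap i (Fin.last n) j))) l
      (1 - lam) else 0) = if y i = 1 then binomCDF (failures y - 1) l (1 - lam) else 0 := by
    intro i
    rw [failures_observed_swap, Equiv.swap_apply_right]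
    split_ifs <;> rfl
  rw [Finset.sum_congr rfl fun i _ => h3 i, sum_boole_mul, failWeight]
  field_simp
  ring

/-- The uniform distribution on the strings with exactly `z` failures. It is the zero function if
`z > m`. -/
noncomputable def uniformLaw (m z : ℕ) (y : Fin m → Fin 2) : ℝ :=
  if failures y = z then ((Finset.univ.filter fun y : Fin m → Fin 2 => failures y = z).card : ℝ)⁻¹
  else 0

lemma sum_uniformLaw_mul {m z : ℕ} (hz : z ≤ m) (φ : ℕ → ℝ) :
    ∑ y, uniformLaw m z y * φ (failures y) = φ z := by
  have hne : (Finset.univ.filter fun y : Fin m → Fin 2 => failures y = z).Nonempty := by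
    refine ⟨fun i => if (i : ℕ) < z then 1 else 0, ?_⟩
    refine Finset.mem_filter.2 ⟨Finset.mem_univ _, ?_⟩
    simp [failures, Fin.card_filter_val_lt, hz]
  have hc : ((Finset.univ.filter fun y : Fin m → Fin 2 => failures y = z).card : ℝ) ≠ 0 := by
    exact_mod_cast hne.card_pos.ne'
  have h : ∀ y : Fin m → Fin 2, uniformLaw m z y * φ (failures y) = if failures y = z then
      ((Finset.univ.filter fun y : Fin m → Fin 2 => failures y = z).card : ℝ)⁻¹ * φ z else 0 := by
    intro y
    unfold uniformLaw
    split_ifs with h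
    · rw [h]
    · simp
  rw [Finset.sum_congr rfl fun y _ => h y, ← Finset.sum_filter, Finset.sum_const, nsmul_eq_mul,
    mul_inv_cancel_left₀ hc]

lemma uniformLaw_mem {m z : ℕ} (hz : z ≤ m) : uniformLaw m z ∈ permInvariantLaws m := by
  refine ⟨⟨fun y => ?_, by simpa using sum_uniformLaw_mul hz fun _ => 1⟩, fun σ y => ?_⟩
  · unfold uniformLaw; split_ifs <;> positivity
  · simp only [uniformLaw, failures_comp_perm]

lemma convexComb_mem {m : ℕ} {P Q : (Fin m → Fin 2) → ℝ} (hP : P ∈ permInvariantLaws m)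
    (hQ : Q ∈ permInvariantLaws m) {w : ℝ} (hw0 : 0 ≤ w) (hw1 : w ≤ 1) :
    (fun y => w * P y + (1 - w) * Q y) ∈ permInvariantLaws m := by
  refine ⟨convex_stdSimplex ℝ _ hP.1 hQ.1 hw0 (sub_nonneg.2 hw1) (by ring), fun σ y => ?_⟩
  simp only [hP.2, hQ.2]

/-- Weak linear programming duality: the intercept `b` is divided by `δ` because the constraint is
`δ ≤ P(L ≤ l)`. -/
lemma upperLimit_le {lam : ℝ} {l n : ℕ} {δ a b : ℝ} (h0 : 0 < δ) (h1 : δ ≤ 1) (hb : 0 ≤ b)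
    (h : ∀ z ≤ n + 1, failWeight lam l n z ≤ a * passWeight lam l n z + b) :
    upperLimit lam l n δ ≤ a + b / δ := by
  obtain ⟨Q, ⟨hQ, hδ⟩, he⟩ := (upperLimit_isGreatest lam l n h0 h1).1
  rw [← he]
  have hp : 0 < probL lam Q l := h0.trans_le hδ
  have h2 : probFailL lam Q l ≤ a * probL lam Q l + b := by
    rw [probFailL_eq hQ, probL_eq hQ, Finset.mul_sum, ← mul_one b, ← hQ.1.2, Finset.mul_sum,
      ← Finset.sum_add_distrib]
    refine Finset.sum_le_sum fun y _ => ?_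
    have := mul_le_mul_of_nonneg_left (h _ (failures_le y)) (hQ.1.1 y)
    linarith
  rw [div_le_iff₀ hp]
  have h3 : b ≤ b / δ * probL lam Q l := by
    calc b = b / δ * δ := by field_simp
      _ ≤ _ := mul_le_mul_of_nonneg_left hδ (by positivity)
  linarith

/-- A mixture of two uniform laws as a feasible point. -/
lemma le_upperLimit {lam : ℝ} {l n z₁ z₂ : ℕ} {δ w : ℝ} (h0 : 0 < δ) (h1 : δ ≤ 1)
    (hw0 : 0 ≤ w) (hw1 : w ≤ 1) (hz₁ : z₁ ≤ n + 1) (hz₂ : z₂ ≤ n + 1)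
    (h : δ ≤ w * passWeight lam l n z₁ + (1 - w) * passWeight lam l n z₂) :
    (w * failWeight lam l n z₁ + (1 - w) * failWeight lam l n z₂) /
      (w * passWeight lam l n z₁ + (1 - w) * passWeight lam l n z₂) ≤ upperLimit lam l n δ := by
  have hQ := convexComb_mem (uniformLaw_mem hz₁) (uniformLaw_mem hz₂) hw0 hw1
  have key : ∀ φ : ℕ → ℝ, ∑ y, (w * uniformLaw (n + 1) z₁ y + (1 - w) * uniformLaw (n + 1) z₂ y) *
      φ (failures y) = w * φ z₁ + (1 - w) * φ z₂ := by
    intro φ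
    rw [← sum_uniformLaw_mul hz₁ φ, ← sum_uniformLaw_mul hz₂ φ, Finset.mul_sum, Finset.mul_sum,
      ← Finset.sum_add_distrib]
    exact Finset.sum_congr rfl fun y _ => by ring
  refine (upperLimit_isGreatest lam l n h0 h1).2 ⟨_, ⟨hQ, ?_⟩, ?_⟩
  · simpa only [probL_eq hQ, key] using h
  · simp only [probFailL_eq hQ, probL_eq hQ, key]

lemma le_upperLimit_single {lam : ℝ} {l n z : ℕ} {δ : ℝ} (h0 : 0 < δ) (h1 : δ ≤ 1)
    (hz : z ≤ n + 1) (h : δ ≤ passWeight lam l n z) :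
    failWeight lam l n z / passWeight lam l n z ≤ upperLimit lam l n δ := by
  simpa using le_upperLimit (w := 1) h0 h1 zero_le_one le_rfl hz hz (by simpa using h)

/-! ### The binomial distribution function in the number of trials -/

section BinomialCDF

variable {lam : ℝ} {l z : ℕ}

lemma binomCDF_nonneg (h0 : 0 ≤ lam) (h1 : lam ≤ 1) : 0 ≤ binomCDF z l (1 - lam) := by
  unfold binomCDF
  rw [sub_sub_cancel]
  have : 0 ≤ 1 - lam := sub_nonneg.2 h1
  positivity

lemma binomCDF_sub_succ (lam : ℝ) (l z : ℕ) :
    binomCDF z l (1 - lam) - binomCDF (z + 1) l (1 - lam) =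
      (1 - lam) * (z.choose l * (1 - lam) ^ l * lam ^ (z - l)) := by
  unfold binomCDF
  simp only [sub_sub_cancel]
  induction l with
  | zero => simp; ring
  | succ l ih =>
    rw [Finset.sum_range_succ, Finset.sum_range_succ _ (l + 1), add_sub_add_comm, ih,
      Nat.choose_succ_succ, Nat.add_sub_add_right]
    rcases Nat.lt_or_ge l z with h | h
    · obtain ⟨k, rfl⟩ := Nat.exists_eq_add_of_lt h
      rw [show l + k + 1 - l = k + 1 by omega, show l + k + 1 - (l + 1) = k by omega]
      push_cast
      ring
    · rw [Nat.choose_eq_zero_of_lt (Nat.lt_succ_of_le h)]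
      push_cast
      ring

lemma binomCDF_eq_one (h : z ≤ l) (p : ℝ) : binomCDF z l p = 1 := by
  have h1 := add_pow p (1 - p) z
  rw [add_sub_cancel, one_pow] at h1
  rw [h1, binomCDF]
  symm
  refine (Finset.sum_subset (Finset.range_mono (Nat.succ_le_succ h)) fun j _ hj => ?_).trans ?_
  · rw [Nat.choose_eq_zero_of_lt (by simpa [Nat.lt_succ_iff] using hj)]; simp
  · exact Finset.sum_congr rfl fun j _ => by ring

lemma binomCDF_antitone (l : ℕ) (h0 : 0 ≤ lam) (h1 : lam ≤ 1) :
    Antitone fun z => binomCDF z l (1 - lam) := by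
  refine antitone_nat_of_succ_le fun z => ?_
  have := binomCDF_sub_succ lam l z
  have h2 : 0 ≤ 1 - lam := sub_nonneg.2 h1
  have h3 : 0 ≤ (1 - lam) * (z.choose l * (1 - lam) ^ l * lam ^ (z - l)) := by positivity
  linarith

lemma binomCDF_le_one (h0 : 0 ≤ lam) (h1 : lam ≤ 1) : binomCDF z l (1 - lam) ≤ 1 :=
  (binomCDF_antitone l h0 h1 (Nat.zero_le z)).trans (binomCDF_eq_one (Nat.zero_le l) _).le

lemma mul_binomCDF_le_succ (h0 : 0 ≤ lam) (h1 : lam ≤ 1) :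
    lam * binomCDF z l (1 - lam) ≤ binomCDF (z + 1) l (1 - lam) := by
  unfold binomCDF
  rw [sub_sub_cancel, Finset.mul_sum]
  have h2 : 0 ≤ 1 - lam := sub_nonneg.2 h1
  refine Finset.sum_le_sum fun j _ => ?_
  rcases Nat.lt_or_ge z j with h | h
  · rw [Nat.choose_eq_zero_of_lt h]
    simp only [Nat.cast_zero, zero_mul, mul_zero]
    positivity
  · rw [Nat.succ_sub h, pow_succ]
    have : (z.choose j : ℝ) ≤ ((z + 1).choose j : ℕ) := by
      exact_mod_cast Nat.choose_le_choose j (Nat.le_succ z)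
    calc lam * (z.choose j * (1 - lam) ^ j * lam ^ (z - j))
        = z.choose j * ((1 - lam) ^ j * (lam ^ (z - j) * lam)) := by ring
      _ ≤ ((z + 1).choose j : ℕ) * ((1 - lam) ^ j * (lam ^ (z - j) * lam)) :=
        mul_le_mul_of_nonneg_right this (by positivity)
      _ = _ := by ring

/-- The ratio bound `B_{z+1,l} / B_{z,l} ≤ λ (z + 1) / (z + 1 - l)`; it holds termwise. -/
lemma succ_binomCDF_le (h0 : 0 ≤ lam) (h1 : lam ≤ 1) :
    ((z : ℝ) + 1 - l) * binomCDF (z + 1) l (1 - lam) ≤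
      lam * (z + 1) * binomCDF z l (1 - lam) := by
  unfold binomCDF
  rw [sub_sub_cancel, Finset.mul_sum, Finset.mul_sum]
  have h2 : 0 ≤ 1 - lam := sub_nonneg.2 h1
  refine Finset.sum_le_sum fun j hj => ?_
  have hjl : j ≤ l := Nat.lt_succ_iff.1 (Finset.mem_range.1 hj)
  have hjl' : (j : ℝ) ≤ l := by exact_mod_cast hjl
  refine (mul_le_mul_of_nonneg_right (show (z : ℝ) + 1 - l ≤ z + 1 - j by linarith)
    (by positivity)).trans (le_of_eq ?_)
  rcases Nat.lt_or_ge z j with h | h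
  · rw [Nat.choose_eq_zero_of_lt h]
    rcases Nat.eq_or_lt_of_le (Nat.succ_le_of_lt h) with rfl | h
    · push_cast; ring
    · rw [Nat.choose_eq_zero_of_lt h]; simp
  · rw [Nat.succ_sub h, pow_succ]
    -- `(z + 1 - j) C(z + 1, j) = (z + 1) C(z, j)`
    have h3 := congrArg (Nat.cast : ℕ → ℝ) (Nat.choose_mul_succ_eq z j)
    rw [Nat.succ_sub h] at h3
    push_cast [Nat.cast_sub h] at h3
    linear_combination (-(1 - lam) ^ j * lam ^ (z - j) * lam) * h3

lemma pow_mul_binomCDF_le (h0 : 0 ≤ lam) (h1 : lam ≤ 1) :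
    lam ^ l * binomCDF z l (1 - lam) ≤ (l + 1) * ((z : ℝ) + 1) ^ l * lam ^ z := by
  unfold binomCDF
  rw [sub_sub_cancel, Finset.mul_sum]
  have h2 : 0 ≤ 1 - lam := sub_nonneg.2 h1
  refine (Finset.sum_le_card_nsmul _ _ (((z : ℝ) + 1) ^ l * lam ^ z) fun j hj => ?_).trans
    (le_of_eq ?_)
  · have hjl : j ≤ l := Nat.lt_succ_iff.1 (Finset.mem_range.1 hj)
    have e1 : (z.choose j : ℝ) ≤ ((z : ℝ) + 1) ^ l := by
      calc (z.choose j : ℝ) ≤ (z : ℝ) ^ j := by exact_mod_cast Nat.choose_le_pow z j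
        _ ≤ ((z : ℝ) + 1) ^ j := by gcongr; linarith
        _ ≤ _ := pow_le_pow_right₀ (by linarith [z.cast_nonneg (α := ℝ)]) hjl
    have e2 : (1 - lam) ^ j ≤ 1 := pow_le_one₀ h2 (by linarith)
    have e3 : lam ^ l * lam ^ (z - j) ≤ lam ^ z := by
      rw [← pow_add]
      exact pow_le_pow_of_le_one h0 h1 (by omega)
    calc lam ^ l * (z.choose j * (1 - lam) ^ j * lam ^ (z - j))
        = z.choose j * (1 - lam) ^ j * (lam ^ l * lam ^ (z - j)) := by ring
      _ ≤ ((z : ℝ) + 1) ^ l * 1 * lam ^ z := by gcongr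
      _ = _ := by ring
  · simp only [Finset.card_range, nsmul_eq_mul]; push_cast; ring

lemma pow_le_binomCDF (h0 : 0 ≤ lam) (h1 : lam ≤ 1) : lam ^ z ≤ binomCDF z l (1 - lam) := by
  induction z with
  | zero => rw [binomCDF_eq_one (Nat.zero_le l), pow_zero]
  | succ z ih =>
    rw [pow_succ']
    exact (mul_le_mul_of_nonneg_left ih h0).trans (mul_binomCDF_le_succ h0 h1)

lemma tendsto_succ_mul_binomCDF (l : ℕ) (h0 : 0 < lam) (h1 : lam < 1) :
    Tendsto (fun z : ℕ => ((z : ℝ) + 1) * binomCDF z l (1 - lam)) atTop (𝓝 0) := by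
  have h := (tendsto_pow_const_mul_const_pow_of_abs_lt_one (l + 1)
    (by rwa [abs_of_pos h0] : |lam| < 1)).comp (tendsto_add_atTop_nat 1)
  have h' := h.const_mul (((l : ℝ) + 1) / lam ^ (l + 1))
  rw [mul_zero] at h'
  refine squeeze_zero (fun z => mul_nonneg (by positivity) (binomCDF_nonneg h0.le h1.le))
    (fun z => ?_) h'
  simp only [Function.comp_apply]
  push_cast
  have h3 := mul_le_mul_of_nonneg_left (pow_mul_binomCDF_le (l := l) (z := z) h0.le h1.le)
    (show 0 ≤ (z : ℝ) + 1 by positivity)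
  rw [div_mul_eq_mul_div, le_div_iff₀ (by positivity)]
  calc ((z : ℝ) + 1) * binomCDF z l (1 - lam) * lam ^ (l + 1)
      = ((z : ℝ) + 1) * (lam ^ l * binomCDF z l (1 - lam)) * lam := by ring
    _ ≤ ((z : ℝ) + 1) * ((l + 1) * ((z : ℝ) + 1) ^ l * lam ^ z) * lam := by gcongr
    _ = _ := by ring

lemma tendsto_binomCDF (l : ℕ) (h0 : 0 < lam) (h1 : lam < 1) :
    Tendsto (fun z : ℕ => binomCDF z l (1 - lam)) atTop (𝓝 0) := by
  refine squeeze_zero (fun z => binomCDF_nonneg h0.le h1.le) (fun z => ?_)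
    (tendsto_succ_mul_binomCDF l h0 h1)
  have := mul_nonneg (z.cast_nonneg (α := ℝ)) (binomCDF_nonneg (z := z) (l := l) h0.le h1.le)
  linarith

lemma binomDiff_pos (h0 : 0 < lam) (h1 : lam < 1) (h : l ≤ z) : 0 < binomDiff z l lam := by
  unfold binomDiff
  rw [binomCDF_sub_succ]
  have h2 : 0 < 1 - lam := sub_pos.2 h1
  have := Nat.choose_pos h
  positivity

lemma binomDiff_nonneg (h0 : 0 ≤ lam) (h1 : lam ≤ 1) : 0 ≤ binomDiff z l lam :=
  sub_nonneg.2 (binomCDF_antitone l h0 h1 (Nat.le_succ z))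

lemma binomDiff_succ (h : l ≤ z) :
    ((z : ℝ) + 1 - l) * binomDiff (z + 1) l lam = lam * (z + 1) * binomDiff z l lam := by
  unfold binomDiff
  rw [binomCDF_sub_succ, binomCDF_sub_succ, Nat.succ_sub h, pow_succ]
  have h3 := congrArg (Nat.cast : ℕ → ℝ) (Nat.choose_mul_succ_eq z l)
  rw [Nat.succ_sub h] at h3
  push_cast [Nat.cast_sub h] at h3
  linear_combination (-(1 - lam) * (1 - lam) ^ l * lam ^ (z - l) * lam) * h3

/-- The increments of `z B_{z-1,l}` against those of `B_{z,l}`, for `z ≥ l`. -/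
lemma increment_eq (h : l ≤ z) :
    lam * (((z : ℝ) + 1) * binomCDF z l (1 - lam) - z * binomCDF (z - 1) l (1 - lam)) =
      lam * binomCDF z l (1 - lam) - (z - l) * binomDiff z l lam := by
  rcases Nat.eq_or_lt_of_le h with rfl | h
  · rw [binomCDF_eq_one le_rfl, binomCDF_eq_one (Nat.sub_le _ _)]; ring
  · obtain ⟨k, rfl⟩ : ∃ k, z = k + 1 := ⟨z - 1, by omega⟩
    have := binomDiff_succ (lam := lam) (Nat.le_of_lt_succ h)
    rw [Nat.add_sub_cancel]
    unfold binomDiff at *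
    push_cast
    linear_combination this

/-- Concavity of the curve of points `(B_{z,l}, z B_{z-1,l})`: its slope between `z` and `z + 1` is
the negative of the given quotient, since `B_{z,l}` decreases, so the slope decreases in the
direction of increasing abscissa. -/
lemma slope_antitone (h0 : 0 < lam) (h1 : lam < 1) :
    AntitoneOn (fun z : ℕ => (((z : ℝ) + 1) * binomCDF z l (1 - lam) -
      z * binomCDF (z - 1) l (1 - lam)) / binomDiff z l lam) (Set.Ici l) := by
  have hs : ∀ z, l ≤ z → (((z : ℝ) + 1) * binomCDF z l (1 - lam) -
      z * binomCDF (z - 1) l (1 - lam)) / binomDiff z l lam =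
      binomCDF z l (1 - lam) / binomDiff z l lam - (z - l) / lam := by
    intro z hz
    have := (binomDiff_pos h0 h1 hz).ne'
    have h' := increment_eq (lam := lam) hz
    field_simp
    linear_combination h'
  refine antitoneOn_of_succ_le Set.ordConnected_Ici fun z _ hz _ => ?_
  have hz : l ≤ z := hz
  rw [Order.succ_eq_add_one, hs z hz, hs (z + 1) (hz.trans z.le_succ)]
  have d1 := binomDiff_pos h0 h1 hz
  have d2 := binomDiff_pos h0 h1 (hz.trans z.le_succ)
  have hl : (0 : ℝ) < z + 1 - l := by
    have : (l : ℝ) ≤ z := by exact_mod_cast hz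
    linarith
  have h3 : binomCDF (z + 1) l (1 - lam) / binomDiff (z + 1) l lam ≤
      binomCDF z l (1 - lam) / binomDiff z l lam := by
    rw [div_le_div_iff₀ d2 d1]
    refine le_of_mul_le_mul_left ?_ hl
    calc ((z : ℝ) + 1 - l) * (binomCDF (z + 1) l (1 - lam) * binomDiff z l lam)
        = (((z : ℝ) + 1 - l) * binomCDF (z + 1) l (1 - lam)) * binomDiff z l lam := by ring
      _ ≤ (lam * (z + 1) * binomCDF z l (1 - lam)) * binomDiff z l lam :=
        mul_le_mul_of_nonneg_right (succ_binomCDF_le h0.le h1.le) d1.le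
      _ = binomCDF z l (1 - lam) * (((z : ℝ) + 1 - l) * binomDiff (z + 1) l lam) := by
        rw [binomDiff_succ hz]; ring
      _ = _ := by ring
  have h4 : ((z : ℝ) - l) / lam ≤ (((z + 1 : ℕ) : ℝ) - l) / lam := by
    push_cast
    gcongr
    linarith
  linarith

/-- The supporting line of the concave curve of points `(B_{z,l}, z B_{z-1,l})` through the points
with indices `m` and `m + 1`. -/
lemma exists_supporting_line (h0 : 0 < lam) (h1 : lam < 1) {m : ℕ} (hm : l ≤ m) :
    ∃ a b : ℝ, 0 ≤ b ∧
      (∀ z : ℕ, z * binomCDF (z - 1) l (1 - lam) ≤ a * binomCDF z l (1 - lam) + b) ∧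
      m * binomCDF (m - 1) l (1 - lam) = a * binomCDF m l (1 - lam) + b ∧
      ((m : ℝ) + 1) * binomCDF m l (1 - lam) = a * binomCDF (m + 1) l (1 - lam) + b := by
  set B : ℕ → ℝ := fun z => binomCDF z l (1 - lam) with hB
  set s : ℕ → ℝ := fun z => (((z : ℝ) + 1) * B z - z * B (z - 1)) / binomDiff z l lam with hs
  -- It suffices that `f`, the height above a line of slope `-s m`, is maximal at `m` and `m + 1`.
  set f : ℕ → ℝ := fun z => z * B (z - 1) + s m * B z with hf
  have hinc : ∀ z, l ≤ z → f (z + 1) - f z = (s z - s m) * binomDiff z l lam := by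
    intro z hz
    have e : s z * binomDiff z l lam = ((z : ℝ) + 1) * B z - z * B (z - 1) :=
      div_mul_cancel₀ _ (binomDiff_pos h0 h1 hz).ne'
    rw [sub_mul, e]
    simp only [hf, binomDiff, hB, Nat.add_sub_cancel]
    push_cast
    ring
  have hanti : AntitoneOn s (Set.Ici l) := slope_antitone h0 h1
  have hup : ∀ z, m ≤ z → f z ≤ f m := by
    intro z hz
    induction z, hz using Nat.le_induction with
    | base => exact le_rfl
    | succ z hz ih =>
      have hlz := hm.trans hz
      have := hinc z hlz
      have h3 : (s z - s m) * binomDiff z l lam ≤ 0 :=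
        mul_nonpos_of_nonpos_of_nonneg (sub_nonpos.2 (hanti hm hlz hz))
          (binomDiff_nonneg h0.le h1.le)
      linarith
  have hdown : ∀ z, z < m → f z ≤ f (z + 1) := by
    intro z hz
    rcases Nat.lt_or_ge z l with h | h
    · simp only [hf, hB, Nat.add_sub_cancel]
      rw [binomCDF_eq_one h.le, binomCDF_eq_one (Nat.succ_le_of_lt h),
        binomCDF_eq_one ((Nat.sub_le z 1).trans h.le)]
      push_cast
      linarith
    · have := hinc z h
      have h3 : 0 ≤ (s z - s m) * binomDiff z l lam :=
        mul_nonneg (sub_nonneg.2 (hanti h hm hz.le)) (binomDiff_nonneg h0.le h1.le)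
      linarith
  have hmax : ∀ z, f z ≤ f m := by
    intro z
    rcases le_total m z with h | h
    · exact hup z h
    · induction h using Nat.decreasingInduction with
      | self => exact le_rfl
      | of_succ k hk ih => exact (hdown k hk).trans ih
  refine ⟨-s m, f m, ?_, fun z => ?_, ?_, ?_⟩
  · -- The curve tends to the origin.
    have ht : Tendsto (fun z => f (z + 1)) atTop (𝓝 0) := by
      have := (tendsto_succ_mul_binomCDF l h0 h1).add
        (((tendsto_binomCDF l h0 h1).comp (tendsto_add_atTop_nat 1)).const_mul (s m))
      simpa [hf, hB] using this
    exact le_of_tendsto' ht fun z => hmax (z + 1)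
  · have := hmax z
    simp only [hf, hB] at *
    linarith
  · simp only [hf, hB]; ring
  · have := hinc m hm
    simp only [sub_self, zero_mul] at this
    simp only [hf, hB, Nat.add_sub_cancel] at *
    push_cast at this
    linarith

end BinomialCDF

/-! ### Fixed confidence level -/

section FixedLevel

variable {lam : ℝ} {l : ℕ}

lemma failWeight_le_passWeight {n z : ℕ} (h0 : 0 ≤ lam) (h1 : lam ≤ 1) (hz : z ≤ n + 1) :
    failWeight lam l n z ≤ passWeight lam l n z := by
  unfold failWeight passWeight
  gcongr
  have hz' : (z : ℝ) ≤ n + 1 := by exact_mod_cast hz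
  have := mul_nonneg (sub_nonneg.2 hz') (binomCDF_nonneg (z := z) (l := l) h0 h1)
  linarith

lemma upperLimit_le_one {n : ℕ} {δ : ℝ} (h0 : 0 ≤ lam) (h1 : lam ≤ 1) (hδ0 : 0 < δ)
    (hδ1 : δ ≤ 1) : upperLimit lam l n δ ≤ 1 := by
  have := upperLimit_le (lam := lam) (l := l) (n := n) (a := 1) hδ0 hδ1 le_rfl fun z hz => by
    simpa using failWeight_le_passWeight h0 h1 hz
  simpa using this

/-- If the line `a x + b` lies above all the points `(B_{z,l}, z B_{z-1,l})`, and the mixture of the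
points with indices `z₁` and `z₂` that has abscissa `δ` lies on it, then `n` times the confidence
limit tends to the height of the line at `δ`, divided by `δ`. -/
lemma tendsto_mul_upperLimit {δ a b w : ℝ} {z₁ z₂ : ℕ} (h0 : 0 ≤ lam)
    (h1 : lam ≤ 1) (hδ0 : 0 < δ) (hδ1 : δ ≤ 1) (hb : 0 ≤ b)
    (hline : ∀ z : ℕ, z * binomCDF (z - 1) l (1 - lam) ≤ a * binomCDF z l (1 - lam) + b)
    (hw0 : 0 ≤ w) (hw1 : w ≤ 1)
    (hB : w * binomCDF z₁ l (1 - lam) + (1 - w) * binomCDF z₂ l (1 - lam) = δ)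
    (hT : w * (z₁ * binomCDF (z₁ - 1) l (1 - lam)) +
      (1 - w) * (z₂ * binomCDF (z₂ - 1) l (1 - lam)) = a * δ + b) :
    Tendsto (fun n : ℕ => n * upperLimit lam l n δ) atTop (𝓝 ((a * δ + b) / δ)) := by
  set B : ℕ → ℝ := fun z => binomCDF z l (1 - lam) with hBdef
  have hBnn : ∀ z, 0 ≤ B z := fun z => binomCDF_nonneg h0 h1
  set M := |a| + b with hM
  have hM0 : 0 ≤ M := by positivity
  have htM : ∀ z : ℕ, z * B (z - 1) ≤ M := fun z => (hline z).trans <| by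
    have : a * B z ≤ |a| * 1 := mul_le_mul (le_abs_self a) (binomCDF_le_one h0 h1) (hBnn z)
      (abs_nonneg a)
    simp only [hBdef] at this
    linarith
  -- `passWeight` exceeds `B z` by at most `M / (n + 1)`.
  have hgap0 : ∀ z : ℕ, 0 ≤ z * B (z - 1) - z * B z := fun z => by
    rw [← mul_sub]
    exact mul_nonneg z.cast_nonneg (sub_nonneg.2 (binomCDF_antitone l h0 h1 (Nat.sub_le z 1)))
  have hgapM : ∀ z : ℕ, z * B (z - 1) - z * B z ≤ M := fun z => by
    have := mul_nonneg (z.cast_nonneg (α := ℝ)) (hBnn z)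
    linarith [htM z]
  have hpass : ∀ n z : ℕ, passWeight lam l n z =
      B z + (z * B (z - 1) - z * B z) * ((n : ℝ) + 1)⁻¹ := fun n z => by
    unfold passWeight
    simp only [hBdef]
    field_simp
    ring
  have hfail : ∀ n z : ℕ, failWeight lam l n z = z * B (z - 1) * ((n : ℝ) + 1)⁻¹ := fun n z => rfl
  have hupper : ∀ n : ℕ, upperLimit lam l n δ ≤ a * ((n : ℝ) + 1)⁻¹ +
      (b + |a| * M * ((n : ℝ) + 1)⁻¹) * ((n : ℝ) + 1)⁻¹ / δ := by
    intro n
    have hx : 0 ≤ ((n : ℝ) + 1)⁻¹ := by positivity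
    refine upperLimit_le hδ0 hδ1 (by positivity) fun z _ => ?_
    have e1 : -(a * (z * B (z - 1) - z * B z)) ≤ |a| * M := by
      refine (neg_le_abs _).trans ?_
      rw [abs_mul, abs_of_nonneg (hgap0 z)]
      exact mul_le_mul_of_nonneg_left (hgapM z) (abs_nonneg a)
    have e2 := mul_le_mul_of_nonneg_right (hline z) hx
    have e3 := mul_le_mul_of_nonneg_right e1 (mul_nonneg hx hx)
    rw [hpass, hfail]
    linarith
  have hlower : ∀ n : ℕ, z₁ ≤ n → z₂ ≤ n → (a * δ + b) * ((n : ℝ) + 1)⁻¹ /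
      (δ + M * ((n : ℝ) + 1)⁻¹) ≤ upperLimit lam l n δ := by
    intro n hn₁ hn₂
    have hx : 0 ≤ ((n : ℝ) + 1)⁻¹ := by positivity
    have key : w * passWeight lam l n z₁ + (1 - w) * passWeight lam l n z₂ = δ +
        (w * (z₁ * B (z₁ - 1) - z₁ * B z₁) + (1 - w) * (z₂ * B (z₂ - 1) - z₂ * B z₂)) *
          ((n : ℝ) + 1)⁻¹ := by
      rw [hpass, hpass, ← hB]; ring
    have hw1' := sub_nonneg.2 hw1
    have g0 : 0 ≤ w * (z₁ * B (z₁ - 1) - z₁ * B z₁) +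
        (1 - w) * (z₂ * B (z₂ - 1) - z₂ * B z₂) :=
      add_nonneg (mul_nonneg hw0 (hgap0 _)) (mul_nonneg hw1' (hgap0 _))
    have gM : w * (z₁ * B (z₁ - 1) - z₁ * B z₁) +
        (1 - w) * (z₂ * B (z₂ - 1) - z₂ * B z₂) ≤ M := by
      have e1 := mul_le_mul_of_nonneg_left (hgapM z₁) hw0
      have e2 := mul_le_mul_of_nonneg_left (hgapM z₂) hw1'
      linarith
    have hge : δ ≤ w * passWeight lam l n z₁ + (1 - w) * passWeight lam l n z₂ := by
      rw [key]; exact le_add_of_nonneg_right (mul_nonneg g0 hx)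
    refine le_trans ?_ (le_upperLimit hδ0 hδ1 hw0 hw1 (hn₁.trans n.le_succ)
      (hn₂.trans n.le_succ) hge)
    have hnum : w * failWeight lam l n z₁ + (1 - w) * failWeight lam l n z₂ =
        (a * δ + b) * ((n : ℝ) + 1)⁻¹ := by
      rw [hfail, hfail, ← hT]; ring
    rw [hnum]
    have hT0 : 0 ≤ a * δ + b := by
      rw [← hT]
      have := hBnn (z₁ - 1)
      have := hBnn (z₂ - 1)
      positivity
    refine div_le_div_of_nonneg_left (mul_nonneg hT0 hx) (hδ0.trans_le hge) ?_
    rw [key]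
    gcongr
  have hx0 : Tendsto (fun n : ℕ => ((n : ℝ) + 1)⁻¹) atTop (𝓝 0) := by
    simpa [one_div] using tendsto_one_div_add_atTop_nhds_zero_nat (𝕜 := ℝ)
  have hx1 : Tendsto (fun n : ℕ => n * ((n : ℝ) + 1)⁻¹) atTop (𝓝 1) := by
    have := hx0.const_sub 1
    rw [sub_zero] at this
    refine this.congr fun n => ?_
    field_simp
    ring
  refine tendsto_of_tendsto_of_tendsto_of_le_of_le'
    (g := fun n : ℕ => n * ((n : ℝ) + 1)⁻¹ * ((a * δ + b) / (δ + M * ((n : ℝ) + 1)⁻¹)))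
    (h := fun n : ℕ => n * ((n : ℝ) + 1)⁻¹ * (a + (b + |a| * M * ((n : ℝ) + 1)⁻¹) / δ))
    ?_ ?_ ?_ ?_
  · have h2 : Tendsto (fun n : ℕ => δ + M * ((n : ℝ) + 1)⁻¹) atTop (𝓝 δ) := by
      simpa using (hx0.const_mul M).const_add δ
    simpa using hx1.mul (tendsto_const_nhds.div h2 hδ0.ne')
  · have h2 := (((hx0.const_mul (|a| * M)).const_add b).div_const δ).const_add a
    have h3 := hx1.mul h2
    rw [mul_zero, add_zero, one_mul] at h3
    rwa [add_div, mul_div_cancel_right₀ _ hδ0.ne']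
  · filter_upwards [eventually_ge_atTop z₁, eventually_ge_atTop z₂] with n hn₁ hn₂
    refine le_trans (le_of_eq ?_) (mul_le_mul_of_nonneg_left (hlower n hn₁ hn₂) n.cast_nonneg)
    ring
  · filter_upwards with n
    refine (mul_le_mul_of_nonneg_left (hupper n) n.cast_nonneg).trans (le_of_eq ?_)
    ring

lemma isLittleO_of_tendsto_mul {u : ℕ → ℝ} {c : ℝ}
    (h : Tendsto (fun n : ℕ => n * u n) atTop (𝓝 c)) :
    (fun n : ℕ => u n - c * (n : ℝ)⁻¹) =o[atTop] fun n : ℕ => (n : ℝ)⁻¹ := by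
  rw [isLittleO_iff_tendsto']
  · have h2 := h.sub_const c
    rw [sub_self] at h2
    refine h2.congr' ?_
    filter_upwards [eventually_ne_atTop 0] with n hn
    have : (n : ℝ) ≠ 0 := by exact_mod_cast hn
    field_simp
  · filter_upwards [eventually_ne_atTop 0] with n hn h
    simp [hn] at h

lemma tendsto_mul_upperLimitDet (k : ℕ) {δ : ℝ} (h0 : 0 < δ) (h1 : δ < 1) :
    Tendsto (fun n : ℕ => n * upperLimitDet k n δ) atTop (𝓝 (((k : ℝ) + 1 - δ) / δ)) := by
  simp only [← upperLimit_zero]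
  have hz : ∀ z, binomCDF z k (1 - 0) = if z ≤ k then 1 else 0 := by
    intro z
    split_ifs with h
    · exact binomCDF_eq_one h _
    · refine Finset.sum_eq_zero fun j hj => ?_
      have := Finset.mem_range.1 hj
      simp only [sub_zero, sub_self]
      rw [zero_pow (by omega), mul_zero]
  have := tendsto_mul_upperLimit (lam := 0) (l := k) (a := -1) (b := k + 1) (w := δ) (z₁ := k)
    (z₂ := k + 1) le_rfl zero_le_one h0 h1.le (by positivity) (fun z => ?_) h0.le h1.le ?_ ?_
  · convert this using 2
    ring
  · simp only [hz]
    rcases Nat.lt_or_ge (k + 1) z with h | h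
    · rw [if_neg (by omega), if_neg (by omega)]
      simp only [mul_zero, zero_add]
      positivity
    · rw [if_pos (by omega)]
      rcases Nat.lt_or_ge k z with h' | h'
      · rw [if_neg (by omega)]
        have : (z : ℝ) ≤ k + 1 := by exact_mod_cast h
        linarith
      · rw [if_pos h']
        have : (z : ℝ) ≤ k := by exact_mod_cast h'
        linarith
  · simp only [hz]
    simp
  · simp only [hz, Nat.sub_le, Nat.add_sub_cancel, le_refl, if_true]
    push_cast
    ring

lemma zUpper_spec (l : ℕ) {δ : ℝ} (h0 : 0 < lam) (h1 : lam < 1) (hδ0 : 0 < δ) (hδ1 : δ < 1) :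
    zUpper l δ lam = zLower l δ lam + 1 ∧ l ≤ zLower l δ lam ∧
      δ < binomCDF (zLower l δ lam) l (1 - lam) ∧
      binomCDF (zLower l δ lam + 1) l (1 - lam) ≤ δ := by
  have hne : {z : ℕ | l ≤ z ∧ binomCDF z l (1 - lam) ≤ δ}.Nonempty :=
    ((eventually_ge_atTop l).and
      ((tendsto_binomCDF l h0 h1).eventually (eventually_le_nhds hδ0))).exists
  have hmem : l ≤ zUpper l δ lam ∧ binomCDF (zUpper l δ lam) l (1 - lam) ≤ δ := Nat.sInf_mem hne
  have hlt : l < zUpper l δ lam := by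
    refine lt_of_le_of_ne hmem.1 fun h => ?_
    have := hmem.2
    rw [← h, binomCDF_eq_one le_rfl] at this
    linarith
  have hsucc : zUpper l δ lam = zLower l δ lam + 1 := by unfold zLower; omega
  have hl : l ≤ zLower l δ lam := by omega
  refine ⟨hsucc, hl, ?_, by rw [← hsucc]; exact hmem.2⟩
  by_contra! h
  have : zUpper l δ lam ≤ zLower l δ lam := Nat.sInf_le ⟨hl, h⟩
  omega

lemma tendsto_mul_upperLimit_coeffG (l : ℕ) {δ : ℝ} (h0 : 0 < lam) (h1 : lam < 1) (hδ0 : 0 < δ)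
    (hδ1 : δ < 1) :
    Tendsto (fun n : ℕ => n * upperLimit lam l n δ) atTop (𝓝 (coeffG l δ lam)) := by
  obtain ⟨hsucc, hl, hlow, hup⟩ := zUpper_spec l h0 h1 hδ0 hδ1
  obtain ⟨a, b, hb, hline, e1, e2⟩ := exists_supporting_line h0 h1 hl
  have hd := binomDiff_pos h0 h1 hl
  set d := binomDiff (zLower l δ lam) l lam with hddef
  have hdd : d = binomCDF (zLower l δ lam) l (1 - lam) -
    binomCDF (zLower l δ lam + 1) l (1 - lam) := rfl
  have hG : coeffG l δ lam = (a * δ + b) / δ := by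
    unfold coeffG
    rw [hsucc, ← hddef, div_eq_div_iff (by positivity) hδ0.ne', e1]
    push_cast
    rw [e2, hdd]
    ring
  rw [hG]
  refine tendsto_mul_upperLimit (w := (δ - binomCDF (zLower l δ lam + 1) l (1 - lam)) / d)
    (z₁ := zLower l δ lam) (z₂ := zLower l δ lam + 1) h0.le h1.le hδ0 hδ1.le hb hline
    (div_nonneg (sub_nonneg.2 hup) hd.le) ((div_le_one hd).2 (by linarith)) ?_ ?_
  · field_simp
    rw [hdd]
    ring
  · rw [Nat.add_sub_cancel, e1]
    push_cast
    rw [e2]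
    field_simp
    rw [hdd]
    ring

end FixedLevel

/-! ### Exponentially small confidence level -/

section ExponentialLevel

variable {lam : ℝ} {l : ℕ}

/-- If the uniform law with `z` failures passes the test only when the unobserved item is a
failure, the confidence limit is `1` at every level which that law reaches. -/
lemma upperLimit_eq_one {n z : ℕ} {δ : ℝ} (h0 : 0 ≤ lam) (h1 : lam ≤ 1) (hδ0 : 0 < δ)
    (hδ1 : δ ≤ 1) (hz : z ≤ n + 1)
    (hz' : ((n : ℝ) + 1 - z) * binomCDF z l (1 - lam) = 0) (h : δ ≤ failWeight lam l n z) :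
    upperLimit lam l n δ = 1 := by
  have he : passWeight lam l n z = failWeight lam l n z := by
    unfold passWeight failWeight
    rw [hz', add_zero]
  refine le_antisymm (upperLimit_le_one h0 h1 hδ0 hδ1) ?_
  have := le_upperLimit_single hδ0 hδ1 hz (he ▸ h)
  rwa [he, div_self (hδ0.trans_le h).ne'] at this

lemma exp_neg_mul_le_one {r : ℝ} (hr : 0 < r) (n : ℕ) : Real.exp (-r * n) ≤ 1 := by
  rw [Real.exp_le_one_iff]
  have := mul_nonneg hr.le n.cast_nonneg
  linarith

/-- The law with `k + 1` failures passes the deterministic test exactly when the unobserved item is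
a failure, which has probability `(k + 1) / (n + 1)`. -/
lemma eventually_upperLimitDet_eq_one (k : ℕ) {r : ℝ} (hr : 0 < r) :
    ∀ᶠ n : ℕ in atTop, upperLimitDet k n (Real.exp (-r * n)) = 1 := by
  have h := (tendsto_pow_const_mul_const_pow_of_abs_lt_one 1
    (r := Real.exp (-r)) (by rw [abs_of_pos (Real.exp_pos _), Real.exp_lt_one_iff]; linarith)).comp
      (tendsto_add_atTop_nat 1)
  filter_upwards [h.eventually (eventually_le_nhds (Real.exp_pos (-r))),
    eventually_ge_atTop k] with n hn hk
  rw [← upperLimit_zero]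
  refine upperLimit_eq_one (z := k + 1) le_rfl zero_le_one (Real.exp_pos _)
    (exp_neg_mul_le_one hr n) (by omega) ?_ ?_
  · refine mul_eq_zero_of_right _ (Finset.sum_eq_zero fun j hj => ?_)
    have := Finset.mem_range.1 hj
    simp only [sub_zero, sub_self]
    rw [zero_pow (by omega), mul_zero]
  · simp only [Function.comp_apply, pow_one, pow_succ (Real.exp (-r)), ← mul_assoc] at hn
    have hn' := le_of_mul_le_mul_right (hn.trans_eq (one_mul _).symm) (Real.exp_pos (-r))
    rw [← Real.exp_nat_mul, mul_comm (n : ℝ)] at hn'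
    unfold failWeight
    rw [Nat.add_sub_cancel, binomCDF_eq_one le_rfl, le_div_iff₀ (by positivity)]
    push_cast at hn' ⊢
    have := k.cast_nonneg (α := ℝ)
    linarith

lemma pow_eq_exp (h0 : 0 < lam) (z : ℕ) : lam ^ z = Real.exp (-(Real.log lam⁻¹ * z)) := by
  rw [Real.log_inv, neg_mul, neg_neg, mul_comm, Real.exp_nat_mul, Real.exp_log h0]

/-- The law with failures only passes the test with probability at least `lam ^ n`. -/
lemma upperLimit_eq_one_of_log_le {r : ℝ} (h0 : 0 < lam) (h1 : lam ≤ 1) (hr : 0 < r)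
    (h : Real.log lam⁻¹ ≤ r) (n : ℕ) : upperLimit lam l n (Real.exp (-r * n)) = 1 := by
  refine upperLimit_eq_one (z := n + 1) h0.le h1 (Real.exp_pos _)
    (exp_neg_mul_le_one hr n) le_rfl (by push_cast; ring) ?_
  unfold failWeight
  push_cast
  rw [mul_div_cancel_left₀ _ (by positivity)]
  refine le_trans ?_ (pow_le_binomCDF h0.le h1)
  rw [pow_eq_exp h0, Real.exp_le_exp]
  have := mul_le_mul_of_nonneg_right h n.cast_nonneg
  linarith

/-- Laws with a proportion of at most `s` failures satisfy the bound with slope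
`s / (s + λ (1 - s))`; the others pass the test with a probability exponentially small in `s`. -/
lemma failWeight_le_of_proportion {n z : ℕ} {s : ℝ} (h0 : 0 < lam) (h1 : lam < 1) (hs0 : 0 < s)
    (hs1 : s ≤ 1) (hz : z ≤ n + 1) :
    failWeight lam l n z ≤ s / (s + lam * (1 - s)) * passWeight lam l n z +
      (l + 1) / lam ^ (l + 1) * ((n : ℝ) + 1) ^ l *
        Real.exp (-(s * Real.log lam⁻¹ * ((n : ℝ) + 1))) := by
  have hN : (0 : ℝ) < n + 1 := by positivity
  have hz' : (z : ℝ) ≤ n + 1 := by exact_mod_cast hz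
  have hden : 0 < s + lam * (1 - s) :=
    add_pos_of_pos_of_nonneg hs0 (mul_nonneg h0.le (sub_nonneg.2 hs1))
  have hb : 0 ≤ (l + 1) / lam ^ (l + 1) * ((n : ℝ) + 1) ^ l *
      Real.exp (-(s * Real.log lam⁻¹ * ((n : ℝ) + 1))) := by positivity
  have hp0 : 0 ≤ passWeight lam l n z :=
    le_trans (div_nonneg (mul_nonneg z.cast_nonneg (binomCDF_nonneg h0.le h1.le)) hN.le)
      (failWeight_le_passWeight h0.le h1.le hz)
  rcases Nat.eq_zero_or_pos z with rfl | hzpos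
  · simp only [failWeight, Nat.cast_zero, zero_mul, zero_div]
    positivity
  obtain ⟨m, rfl⟩ : ∃ m, z = m + 1 := ⟨z - 1, by omega⟩
  have hB0 : 0 ≤ binomCDF m l (1 - lam) := binomCDF_nonneg h0.le h1.le
  rcases le_or_gt ((m + 1 : ℕ) : ℝ) (s * (n + 1)) with h | h
  · refine le_trans ?_ (le_add_of_nonneg_right hb)
    unfold failWeight passWeight
    rw [Nat.add_sub_cancel, ← mul_div_assoc]
    refine div_le_div_of_nonneg_right ?_ hN.le
    rw [div_mul_eq_mul_div, le_div_iff₀ hden]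
    have e1 := mul_le_mul_of_nonneg_left
      (mul_binomCDF_le_succ (z := m) (l := l) h0.le h1.le) (sub_nonneg.2 hz')
    have e2 := mul_le_mul_of_nonneg_left h (mul_nonneg h0.le hB0)
    have e3 := mul_le_mul_of_nonneg_left e1 hs0.le
    linarith
  · refine le_trans ?_ (le_add_of_nonneg_left (by positivity))
    have e1 : failWeight lam l n (m + 1) ≤ binomCDF m l (1 - lam) := by
      unfold failWeight
      rw [Nat.add_sub_cancel, div_le_iff₀ hN, mul_comm]
      exact mul_le_mul_of_nonneg_left hz' hB0
    have e2 := pow_mul_binomCDF_le (l := l) (z := m) h0.le h1.le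
    have e3 : lam ^ (m + 1) ≤ Real.exp (-(s * Real.log lam⁻¹ * ((n : ℝ) + 1))) := by
      rw [pow_eq_exp h0, Real.exp_le_exp]
      have hL : 0 ≤ Real.log lam⁻¹ := Real.log_nonneg ((one_le_inv₀ h0).2 h1.le)
      have := mul_le_mul_of_nonneg_left h.le hL
      linarith
    have e4 : (m : ℝ) + 1 ≤ n + 1 := by push_cast at hz'; exact hz'
    refine e1.trans ?_
    rw [div_mul_eq_mul_div, div_mul_eq_mul_div, le_div_iff₀ (by positivity)]
    calc binomCDF m l (1 - lam) * lam ^ (l + 1)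
        = lam ^ l * binomCDF m l (1 - lam) * lam := by ring
      _ ≤ (l + 1) * ((m : ℝ) + 1) ^ l * lam ^ m * lam := by gcongr
      _ = (l + 1) * ((m : ℝ) + 1) ^ l * lam ^ (m + 1) := by ring
      _ ≤ _ := by gcongr

lemma eventually_upperLimit_lt {r s c : ℝ} (h0 : 0 < lam) (h1 : lam < 1) (hr : 0 < r)
    (hs0 : 0 < s) (hs1 : s ≤ 1) (hrs : r < s * Real.log lam⁻¹)
    (hc : s / (s + lam * (1 - s)) < c) :
    ∀ᶠ n : ℕ in atTop, upperLimit lam l n (Real.exp (-r * n)) < c := by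
  set L := Real.log lam⁻¹
  have h := ((tendsto_pow_const_mul_const_pow_of_abs_lt_one l
    (r := Real.exp (-(s * L - r)))
      (by rw [abs_of_pos (Real.exp_pos _), Real.exp_lt_one_iff]; linarith)).comp
      (tendsto_add_atTop_nat 1)).const_mul ((l + 1) / lam ^ (l + 1))
  rw [mul_zero] at h
  filter_upwards [h.eventually (eventually_lt_nhds (sub_pos.2 hc))] with n hn
  refine lt_of_le_of_lt (upperLimit_le (Real.exp_pos _) (exp_neg_mul_le_one hr n) (by positivity)
    fun z hz => failWeight_le_of_proportion h0 h1 hs0 hs1 hz) ?_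
  refine lt_of_le_of_lt (add_le_add_right ?_ _) (lt_sub_iff_add_lt'.1 hn)
  simp only [Function.comp_apply]
  rw [mul_div_assoc, ← Real.exp_sub, ← Real.exp_nat_mul, mul_assoc]
  push_cast
  gcongr
  linarith

lemma tendsto_upperLimit_exp {r : ℝ} (h0 : 0 < lam) (h1 : lam < 1) (hr : 0 < r)
    (hrL : r ≤ Real.log lam⁻¹) :
    Tendsto (fun n : ℕ => upperLimit lam l n (Real.exp (-r * n))) atTop
      (𝓝 (r / (r + lam * (Real.log lam⁻¹ - r)))) := by
  set L := Real.log lam⁻¹ with hL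
  have hL0 : 0 < L := hr.trans_le hrL
  set ρ := r / L with hρ
  have hρ0 : 0 < ρ := div_pos hr hL0
  have hρ1 : ρ ≤ 1 := (div_le_one hL0).2 hrL
  have hρL : ρ * L = r := div_mul_cancel₀ _ hL0.ne'
  have hden : 0 < ρ + lam * (1 - ρ) :=
    add_pos_of_pos_of_nonneg hρ0 (mul_nonneg h0.le (sub_nonneg.2 hρ1))
  have hlim : r / (r + lam * (L - r)) = ρ / (ρ + lam * (1 - ρ)) := by
    rw [← hρL, show ρ * L + lam * (L - ρ * L) = (ρ + lam * (1 - ρ)) * L by ring,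
      mul_div_mul_right _ _ hL0.ne']
  rw [hlim]
  refine tendsto_order.2 ⟨fun c hc => ?_, fun c hc => ?_⟩
  · -- The uniform law with `z = ⌊ρ n⌋` failures passes with probability at least `λ ^ z`.
    have hz : Tendsto (fun n : ℕ => (⌊ρ * n⌋₊ : ℝ) / n) atTop (𝓝 ρ) :=
      (tendsto_nat_floor_mul_div_atTop hρ0.le).comp tendsto_natCast_atTop_atTop
    have hi : Tendsto (fun n : ℕ => (n : ℝ)⁻¹) atTop (𝓝 0) :=
      tendsto_inv_atTop_zero.comp tendsto_natCast_atTop_atTop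
    have hnum : Tendsto (fun n : ℕ => (⌊ρ * n⌋₊ : ℝ) / n - l * (n : ℝ)⁻¹) atTop (𝓝 ρ) := by
      simpa using hz.sub (hi.const_mul (l : ℝ))
    have hrest : Tendsto (fun n : ℕ => lam * (1 + (n : ℝ)⁻¹ - (⌊ρ * n⌋₊ : ℝ) / n)) atTop
        (𝓝 (lam * (1 - ρ))) := by
      simpa using ((hi.const_add 1).sub hz).const_mul lam
    have hq := hnum.div (hnum.add hrest) hden.ne'
    filter_upwards [hq.eventually (eventually_gt_nhds hc), eventually_gt_atTop 0,
      hnum.eventually (eventually_gt_nhds hρ0)] with n hn hn0 hnl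
    have hn0' : (0 : ℝ) < n := by exact_mod_cast hn0
    have hzr : (⌊ρ * n⌋₊ : ℝ) ≤ ρ * n := Nat.floor_le (by positivity)
    refine hn.trans_le ?_
    simp only [Pi.div_apply]
    generalize ⌊ρ * n⌋₊ = z at *
    have hlz : (0 : ℝ) < z - l := by
      have := mul_pos hnl hn0'
      field_simp at this
      linarith
    have hzn' : (z : ℝ) ≤ n := hzr.trans (mul_le_of_le_one_left hn0'.le hρ1)
    have hzn : z ≤ n := by exact_mod_cast hzn'
    have hz0 : z ≠ 0 := by
      rintro rfl
      have := l.cast_nonneg (α := ℝ)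
      simp only [Nat.cast_zero] at hlz
      linarith
    obtain ⟨m, rfl⟩ := Nat.exists_eq_succ_of_ne_zero hz0
    rw [Nat.succ_eq_add_one] at *
    set B := binomCDF (m + 1) l (1 - lam) with hB
    set B' := binomCDF m l (1 - lam) with hB'
    have hBpow : lam ^ (m + 1) ≤ B := pow_le_binomCDF h0.le h1.le
    have hBpos : 0 < B := (pow_pos h0 _).trans_le hBpow
    have hBB' : B ≤ B' := binomCDF_antitone l h0.le h1.le (Nat.le_succ m)
    have hB'pos := hBpos.trans_le hBB'
    have hpass : passWeight lam l n (m + 1) =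
        (((m + 1 : ℕ) : ℝ) * B' + ((n : ℝ) + 1 - (m + 1 : ℕ)) * B) / (n + 1) := rfl
    have hfeas : Real.exp (-r * n) ≤ passWeight lam l n (m + 1) := by
      have e1 : Real.exp (-r * n) ≤ B := by
        refine le_trans ?_ hBpow
        rw [pow_eq_exp h0, Real.exp_le_exp, ← hρL, ← hL]
        have := mul_le_mul_of_nonneg_left hzr hL0.le
        linarith
      refine e1.trans ?_
      rw [hpass, le_div_iff₀ (by positivity)]
      have := mul_le_mul_of_nonneg_left hBB' ((m + 1).cast_nonneg (α := ℝ))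
      linarith
    refine le_trans ?_ (le_upperLimit_single (Real.exp_pos _) (exp_neg_mul_le_one hr n)
      (hzn.trans n.le_succ) hfeas)
    have hfail : failWeight lam l n (m + 1) = ((m + 1 : ℕ) : ℝ) * B' / (n + 1) := rfl
    have hR : (((m + 1 : ℕ) : ℝ) - l) * B ≤ lam * (m + 1 : ℕ) * B' := by
      have := succ_binomCDF_le (z := m) (l := l) h0.le h1.le
      push_cast
      exact this
    rw [hpass, hfail, div_div_div_cancel_right₀ (by positivity)]
    have e : ((((m + 1 : ℕ) : ℝ) / n - l * (n : ℝ)⁻¹) / (((m + 1 : ℕ) : ℝ) / n - l * (n : ℝ)⁻¹ +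
        lam * (1 + (n : ℝ)⁻¹ - ((m + 1 : ℕ) : ℝ) / n))) =
        (((m + 1 : ℕ) : ℝ) - l) / (((m + 1 : ℕ) : ℝ) - l + lam * (n + 1 - (m + 1 : ℕ))) := by
      rw [← mul_div_mul_right _ _ hn0'.ne']
      congr 1 <;> field_simp
    rw [e]
    generalize ((m + 1 : ℕ) : ℝ) = x at *
    have hx0 : 0 < x := by linarith [l.cast_nonneg (α := ℝ)]
    have hx1 : 0 ≤ (n : ℝ) + 1 - x := by linarith
    rw [div_le_div_iff₀ (by positivity) (by positivity)]
    have := mul_le_mul_of_nonneg_left hR hx1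
    linarith
  · rcases hρ1.eq_or_lt with h | h
    · rw [h] at hc
      simp only [sub_self, mul_zero, add_zero, div_one] at hc
      exact Eventually.of_forall fun n => (upperLimit_le_one h0.le h1.le (Real.exp_pos _)
        (exp_neg_mul_le_one hr n)).trans_lt hc
    · have hcont : ContinuousAt (fun s : ℝ => s / (s + lam * (1 - s))) ρ :=
        continuousAt_id.div (by fun_prop) hden.ne'
      obtain ⟨s, hs, hs1, hsρ⟩ := (((hcont.eventually (eventually_lt_nhds hc)).filter_mono
        nhdsWithin_le_nhds).and (((eventually_le_nhds h).filter_mono nhdsWithin_le_nhds).and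
          (eventually_mem_nhdsWithin (s := Set.Ioi ρ)))).exists
      exact eventually_upperLimit_lt h0 h1 hr (hρ0.trans hsρ) hs1
        (by rw [← hρL]; exact mul_lt_mul_of_pos_right hsρ hL0) hs

end ExponentialLevel

end RandomSampling

open RandomSampling
theorem mainTheorem2 (lam : ℝ) (hlam0 : 0 < lam) (hlam1 : lam < 1) (k₀ : ℕ) :
    (∀ δ : ℝ, 0 < δ → δ < 1 →
      ((fun n : ℕ => upperLimitDet k₀ n δ - ((k₀ : ℝ) + 1 - δ) / δ * (n : ℝ)⁻¹)
          =o[atTop] fun n : ℕ => (n : ℝ)⁻¹) ∧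
      ((fun n : ℕ => upperLimit lam ⌈(1 - lam) * (k₀ : ℝ)⌉₊ n δ
            - coeffG ⌈(1 - lam) * (k₀ : ℝ)⌉₊ δ lam * (n : ℝ)⁻¹)
          =o[atTop] fun n : ℕ => (n : ℝ)⁻¹)) ∧
    (∀ r : ℝ, 0 < r →
      (∀ᶠ n : ℕ in atTop, upperLimitDet k₀ n (Real.exp (-r * n)) = 1) ∧
      (r ≤ Real.log lam⁻¹ →
        Tendsto (fun n : ℕ => upperLimit lam ⌈(1 - lam) * (k₀ : ℝ)⌉₊ n (Real.exp (-r * n)))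
          atTop (𝓝 (r / (r + lam * (Real.log lam⁻¹ - r))))) ∧
      (Real.log lam⁻¹ < r →
        ∀ᶠ n : ℕ in atTop,
          upperLimit lam ⌈(1 - lam) * (k₀ : ℝ)⌉₊ n (Real.exp (-r * n)) = 1)) :=
  ⟨fun _ h0 h1 => ⟨isLittleO_of_tendsto_mul (tendsto_mul_upperLimitDet k₀ h0 h1),
      isLittleO_of_tendsto_mul (tendsto_mul_upperLimit_coeffG _ hlam0 hlam1 h0 h1)⟩,
    fun _ hr => ⟨eventually_upperLimitDet_eq_one k₀ hr, tendsto_upperLimit_exp hlam0 hlam1 hr,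
      fun h => Eventually.of_forall (upperLimit_eq_one_of_log_le hlam0 hlam1.le hr h.le)⟩⟩
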